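/- A subset $S$ of a space $X$ is \emph{$C^*$-embedded} if every bounded continuous $f:S\to\mathbb R$ has a bounded continuous extension to $X$. A space is \emph{realcompact} if it can be embedded as a closed subset in a power of $\mathbb R$. A \emph{closed copy of $\mathbb N$} in $X$ is a closed subset of $X$ that, with the subspace topology, is homeomorphic to the discrete space $\mathbb N$. Let $D=2^{<\omega}$ be the set of finite $0$-$1$-sequences with the discrete topology, and let $cD=D\cup 2^\omega$ be topologized by making the points of $D$ isolated and giving $x\in2^\omega$ the neighbourhood base of all wedges $U(x,n)=\{s\in cD: x{\restriction}n\subseteq s\}$, $n\in\omega$; this is a Hausdorff compactification of $D$. Let $e:\beta D\to cD$ be the continuous extension of the identity map of $D$, let $D^*=\beta D\setminus D$, and let $K_x=\{u\in D^*:e(u)=x\}$ for $x\in2^\omega$. Let $\mathbb C=2^\omega\cup\{\infty\}$, where the points of $2^\omega$ are isolated and the sets that contain $\infty$ and have countable complement form a neighbourhood base at $\infty$. Let $$\mathbb A=(\mathbb C\times D)\cup\bigcup_{x\in2^\omega}\{x\}\times K_x$$ be given the topology of a subspace of $\mathbb C\times\beta D$, and put $T=\bigcup_{x\in2^\omega}\{x\}\times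 K_x$ (the top line) and $R=\{\infty\}\times D$. Let $Q$ be the quotient space of $\mathbb A\times\{0,1\}$ obtained by identifying $(t,0)$ and $(t,1)$ for every $t\in T$, and let $R_i$ be the image of $R\times\{i\}$ in $Q$ ($i=0,1$). Then: 1. $Q$ is realcompact. 2. $R_0$ and $R_1$ are disjoint closed copies of $\mathbb N$ in $Q$, and each of them is $C^*$-embedded in $Q$. 3. $R_0\cup R_1$ is a closed copy of $\mathbb N$ in $Q$ that is not $C^*$-embedded in $Q$. 4. The set $C(Q)$ of continuous functions $Q\to\mathbb R$ has cardinality $\mathfrak c$. 5. For every set $I$ of cardinality $\mathfrak c$ there is an embedding $\varphi$ of $Q$ onto a closed subset of $\mathbb R^I$ such that $\varphi[R_0\cup R_1]$ is a closed copy of $\mathbb N$ in $\mathbb R^I$ that is not $C^*$-embedded in $\mathbb R^I$. In particular, $\mathbb R^{\mathfrak c}$ contains a closed copy of $\mathbb N$ that is not $C^*$-embedded. 6. Consequently, it is not true that in every realcompact space the union of two $C^*$-embedded closed copies of $\mathbb N$ is $C^*$-embedded. -/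

import Mathlib

open Topology Set

universe u

/-- A subset `S` of `X` is `C*`-embedded if every bounded continuous `f : S → ℝ` admits a
bounded continuous extension to `X`. -/
def CStarEmbedded {X : Type*} [TopologicalSpace X] (S : Set X) : Prop :=
  ∀ f : BoundedContinuousFunction S ℝ, ∃ g : BoundedContinuousFunction X ℝ,
    ∀ x : S, g (x : X) = f x

/-- `X` is realcompact if it is homeomorphic to a closed subset of some power of the real line. -/
def Realcompact (X : Type u) [TopologicalSpace X] : Prop :=
  ∃ (I : Type u) (φ : X → (I → ℝ)), IsClosedEmbedding φ

/-- A closed copy of `ℕ` in `X`: a closed subset whose subspace topology is that of the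
discrete space `ℕ`. -/
def IsClosedCopyOfNat {X : Type*} [TopologicalSpace X] (S : Set X) : Prop :=
  IsClosed S ∧ Nonempty (S ≃ₜ ℕ)

namespace Plank

/-- The tree `D = 2^{<ω}` of finite 0-1-sequences. -/
def D : Type := List Bool

/-- `D` carries the discrete topology. -/
instance : TopologicalSpace D := ⊥

instance : DiscreteTopology D := ⟨rfl⟩

/-- The set `cD = D ∪ 2^ω` of all finite and infinite 0-1-sequences. -/
inductive CD : Type
  | node (s : D) : CD
  | branch (x : ℕ → Bool) : CD

/-- A finite or infinite sequence viewed as a partial function on `ℕ`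
(`none` where it is undefined). -/
def CD.val : CD → ℕ → Option Bool
  | .node s, i => (show List Bool from s)[i]?
  | .branch x, i => some (x i)

/-- The wedge `U(x, n) = {s ∈ cD : x ↾ n ⊆ s}`. -/
def wedge (x : ℕ → Bool) (n : ℕ) : Set CD :=
  {t | ∀ i < n, t.val i = some (x i)}

/-- The topology of `cD`: the points of `D` are isolated, and the wedges `U(x, n)`, `n ∈ ℕ`,
form a neighbourhood base at `x ∈ 2^ω`. -/
instance : TopologicalSpace CD where
  IsOpen W := ∀ x, CD.branch x ∈ W → ∃ n, wedge x n ⊆ W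
  isOpen_univ := fun _ _ => ⟨0, subset_univ _⟩
  isOpen_inter := by
    intro V W hV hW x hx
    obtain ⟨n, hn⟩ := hV x hx.1
    obtain ⟨m, hm⟩ := hW x hx.2
    exact ⟨max n m, fun t ht => ⟨hn fun i hi => ht i (lt_of_lt_of_le hi (le_max_left _ _)),
      hm fun i hi => ht i (lt_of_lt_of_le hi (le_max_right _ _))⟩⟩
  isOpen_sUnion := by
    intro S hS x hx
    obtain ⟨W, hW, hxW⟩ := hx
    obtain ⟨n, hn⟩ := hS W hW x hxW
    exact ⟨n, hn.trans (subset_sUnion_of_mem hW)⟩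

theorem CD.isOpen_iff {W : Set CD} :
    IsOpen W ↔ ∀ x, CD.branch x ∈ W → ∃ n, wedge x n ⊆ W := Iff.rfl

theorem CD.isOpen_coord (i : ℕ) (v : Option Bool) : IsOpen {t : CD | t.val i = v} := by
  rw [CD.isOpen_iff]
  intro x hx
  refine ⟨i + 1, fun t ht => ?_⟩
  exact (ht i (Nat.lt_succ_self i)).trans hx

theorem CD.isOpen_node (s : D) : IsOpen {CD.node s} := by
  rw [CD.isOpen_iff]
  intro x hx
  cases hx

theorem CD.val_node_eq_none_iff (s : D) (i : ℕ) :
    (CD.node s).val i = none ↔ List.length s ≤ i :=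
  List.getElem?_eq_none_iff

theorem CD.val_injective : Function.Injective CD.val := by
  rintro (s | x) (t | y) h
  · exact congrArg CD.node (List.ext_getElem? fun i => congrFun h i)
  · have h1 := congrFun h (List.length s)
    exact absurd ((CD.val_node_eq_none_iff s _).2 le_rfl) (h1 ▸ Option.some_ne_none _)
  · have h1 := congrFun h (List.length t)
    exact absurd ((CD.val_node_eq_none_iff t _).2 le_rfl) (h1 ▸ Option.some_ne_none _)
  · exact congrArg CD.branch (funext fun i => Option.some.inj (congrFun h i))

instance : T2Space CD where
  t2 := by
    intro t t' h
    obtain ⟨i, hi⟩ := Function.ne_iff.1 (CD.val_injective.ne h)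
    refine ⟨_, _, CD.isOpen_coord i (t.val i), CD.isOpen_coord i (t'.val i), rfl, rfl, ?_⟩
    rw [Set.disjoint_left]
    intro z hz hz'
    exact hi (Eq.trans (Eq.symm hz) hz')

instance : CompactSpace CD where
  isCompact_univ := by
    rw [isCompact_iff_ultrafilter_le_nhds]
    intro F _
    have h1 : ∀ i, ∃ v : Option Bool, {t : CD | t.val i = v} ∈ F := by
      intro i
      obtain ⟨v, hv⟩ := Ultrafilter.eq_pure_of_finite (F.map (fun t => t.val i))
      refine ⟨v, ?_⟩
      have h2 : ({v} : Set (Option Bool)) ∈ F.map (fun t => t.val i) := by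
        rw [hv]; exact rfl
      exact h2
    choose v hv using h1
    have hfin : ∀ n, {t : CD | ∀ i < n, t.val i = v i} ∈ F := by
      intro n
      have h3 := (Filter.biInter_mem (f := (F : Filter CD)) (s := fun i => {t : CD | t.val i = v i})
        (Set.finite_Iio n)).2 fun i _ => hv i
      refine Filter.mem_of_superset h3 fun t ht i hi => ?_
      exact Set.mem_iInter₂.1 ht i hi
    by_cases hall : ∀ i, ∃ b, v i = some b
    · choose x hx using hall
      refine ⟨CD.branch x, mem_univ _, fun W hW => ?_⟩
      obtain ⟨V, hVW, hV, hxV⟩ := mem_nhds_iff.1 hW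
      obtain ⟨n, hn⟩ := CD.isOpen_iff.1 hV x hxV
      exact Filter.mem_of_superset (hfin n)
        fun t ht => hVW (hn fun i hi => (ht i hi).trans (hx i))
    · push Not at hall
      obtain ⟨i, hi⟩ := hall
      have hvi : v i = none := Option.eq_none_iff_forall_ne_some.2 hi
      obtain ⟨t, ht⟩ := F.nonempty_of_mem (hfin (i + 1))
      have hsub : {t : CD | ∀ j < i + 1, t.val j = v j} ⊆ {t} := by
        intro t' ht'
        have key : ∀ z : CD, (∀ j < i + 1, z.val j = v j) → ∀ j, i ≤ j → z.val j = none := by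
          rintro (s | x) hz j hj
          · have h4 := (hz i (Nat.lt_succ_self i)).trans hvi
            exact (CD.val_node_eq_none_iff s j).2 (((CD.val_node_eq_none_iff s i).1 h4).trans hj)
          · have h4 := (hz i (Nat.lt_succ_self i)).trans hvi
            simp [CD.val] at h4
        refine CD.val_injective (funext fun j => ?_)
        rcases lt_or_ge j (i + 1) with hj | hj
        · exact (ht' j hj).trans (ht j hj).symm
        · exact (key t' ht' j (by omega)).trans (key t ht j (by omega)).symm
      refine ⟨t, mem_univ _, fun W hW => ?_⟩
      exact Filter.mem_of_superset (hfin (i + 1))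
        (hsub.trans (singleton_subset_iff.2 (mem_of_mem_nhds hW)))

/-- The map `e : βD → cD` that extends the identity map of `D`. -/
noncomputable def e : StoneCech D → CD :=
  stoneCechExtend (g := CD.node) continuous_of_discreteTopology

/-- `D* = βD \ D`. -/
def remainder : Set (StoneCech D) := (range (stoneCechUnit : D → StoneCech D))ᶜ

/-- `K_x = {u ∈ D* : e(u) = x}`. -/
def K (x : ℕ → Bool) : Set (StoneCech D) := {u | u ∈ remainder ∧ e u = CD.branch x}

/-- The set `ℂ = 2^ω ∪ {∞}`. -/
inductive C : Type
  | pt (x : ℕ → Bool) : C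
  | infty : C

/-- The points of `2^ω` are isolated in `ℂ`, and the sets that contain `∞` and have a countable
complement form a neighbourhood base at `∞`. -/
instance : TopologicalSpace C where
  IsOpen U := C.infty ∈ U → Uᶜ.Countable
  isOpen_univ := by simp
  isOpen_inter := by
    intro U V hU hV h
    rw [compl_inter]
    exact (hU h.1).union (hV h.2)
  isOpen_sUnion := by
    intro S hS h
    obtain ⟨U, hU, hxU⟩ := h
    exact (hS U hU hxU).mono (compl_subset_compl.2 (subset_sUnion_of_mem hU))

/-- The underlying set `(ℂ × D) ∪ ⋃ₓ {x} × K_x` of the plank `𝔸`. -/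
def plankSet : Set (C × StoneCech D) :=
  (univ ×ˢ range (stoneCechUnit : D → StoneCech D)) ∪ ⋃ x : ℕ → Bool, {C.pt x} ×ˢ K x

/-- The plank `𝔸`, as a subspace of `ℂ × βD`. -/
abbrev A : Type := plankSet

/-- The top line `T = ⋃ₓ {x} × K_x`. -/
def T : Set A := {a | (a : C × StoneCech D) ∈ ⋃ x : ℕ → Bool, {C.pt x} ×ˢ K x}

/-- The right-hand side `R = {∞} × D`. -/
def R : Set A :=
  {a | (a : C × StoneCech D) ∈ {C.infty} ×ˢ range (stoneCechUnit : D → StoneCech D)}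

/-- The equivalence relation on `𝔸 × {0, 1}` that identifies `(t, 0)` and `(t, 1)` for
every `t ∈ T`. -/
def glue : Setoid (A × Fin 2) where
  r p q := p.1 = q.1 ∧ (p.2 = q.2 ∨ p.1 ∈ T)
  iseqv :=
    { refl := fun _ => ⟨rfl, Or.inl rfl⟩
      symm := fun {_ _} h => ⟨h.1.symm, h.2.elim (fun h1 => Or.inl h1.symm)
        (fun h1 => Or.inr (h.1 ▸ h1))⟩
      trans := fun {_ _ _} h k => ⟨h.1.trans k.1, h.2.elim
        (fun h1 => k.2.elim (fun k1 => Or.inl (h1.trans k1))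
          (fun k1 => Or.inr (h.1.symm ▸ k1))) Or.inr⟩ }

/-- The quotient of `𝔸 × {0, 1}` under this relation, with the quotient topology. -/
abbrev Q : Type := Quotient glue

/-- The copy `R × {i}` of the right-hand side in the quotient. -/
def RCopy (i : Fin 2) : Set Q := (fun p : A × Fin 2 => Quotient.mk glue p) '' (R ×ˢ {i})

end Plank

/-! The point `∞` of `ℂ` is a P-point: a continuous real function on `ℂ` equals its value at `∞` off
a countable set (`C.countable_ne`). Suppose the function that is `0` on `R₀` and `1` on `R₁` extends
to `Q`. As `D` is countable and `2^ω` is not, for some `x` the extension is `0` on `{x} × D × {0}`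
and `1` on `{x} × D × {1}`. A point of `{x} × K_x` is a limit of both sets, because its two copies
are glued; so `0 = 1`. A function on a single `R_i`, however, extends over `βD` and is pulled back
along the projection of `Q` to `βD`.

For realcompactness, take an ultrafilter along which every function in `C(Q)` converges. Its
projections converge to some `c ∈ ℂ` and `v ∈ βD`. If `(c, v)` were missing from the plank, then `e
v = y` for some `y ≠ c`, and `blowUp y` would be unbounded along the ultrafilter. As `C(Q)` also
separates points, evaluation embeds `Q` as a closed set in `ℝ^C(Q)`, where `|C(Q)| = 𝔠`. An
extension over the power would restrict to one over `Q`, so the failure of `C*`-embedding carries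
over. -/

open Filter

/-! ### Evaluation embeddings and transfer along closed embeddings -/

section General

/-- If the continuous real-valued functions on `X` separate points, and every ultrafilter along
which all of them converge is itself convergent, then evaluation is a closed embedding of `X` into
a power of `ℝ`. -/
theorem isClosedEmbedding_eval {X : Type*} [TopologicalSpace X] {I : Type*} (F : I → C(X, ℝ))
    (hF : Function.Surjective F) (hsep : ∀ x y : X, (∀ f : C(X, ℝ), f x = f y) → x = y)
    (hlim : ∀ U : Ultrafilter X, (∀ f : C(X, ℝ), ∃ r, Tendsto f U (𝓝 r)) →
      ∃ x, (U : Filter X) ≤ 𝓝 x) :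
    IsClosedEmbedding (fun x i => F i x : X → I → ℝ) := by
  have hc : Continuous (fun x i => F i x : X → I → ℝ) := continuous_pi fun i => (F i).continuous
  refine .of_continuous_injective_isClosedMap hc ?_ (IsProperMap.isClosedMap ?_)
  · intro x y h
    refine hsep x y fun f => ?_
    obtain ⟨i, rfl⟩ := hF f
    exact congrFun h i
  · refine isProperMap_iff_ultrafilter.2 ⟨hc, fun {U p} hU => ?_⟩
    have hU' := tendsto_pi_nhds.1 hU
    obtain ⟨x, hx⟩ := hlim U fun f => by
      obtain ⟨i, rfl⟩ := hF f
      exact ⟨p i, hU' i⟩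
    exact ⟨x, tendsto_nhds_unique ((hc.tendsto x).mono_left hx) hU, hx⟩

theorem IsClosedCopyOfNat.range {N X : Type*} [TopologicalSpace N] [DiscreteTopology N]
    [TopologicalSpace X] {k : N → X} (hk : IsClosedEmbedding k) (a : N ≃ ℕ) :
    IsClosedCopyOfNat (range k) :=
  ⟨hk.isClosed_range, ⟨hk.isEmbedding.toHomeomorph.symm.trans
    a.toHomeomorphOfDiscrete⟩⟩

theorem IsClosedCopyOfNat.image {X Y : Type*} [TopologicalSpace X] [TopologicalSpace Y]
    {φ : X → Y} (hφ : IsClosedEmbedding φ) {S : Set X} (hS : IsClosedCopyOfNat S) :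
    IsClosedCopyOfNat (φ '' S) :=
  ⟨hφ.isClosedMap S hS.1, hS.2.map fun h => (hφ.isEmbedding.homeomorphImage S).symm.trans h⟩

theorem CStarEmbedded.of_image {X Y : Type*} [TopologicalSpace X] [TopologicalSpace Y]
    {φ : X → Y} (hφ : IsEmbedding φ) {S : Set X} (hS : CStarEmbedded (φ '' S)) :
    CStarEmbedded S := by
  intro f
  let h := hφ.homeomorphImage S
  obtain ⟨g, hg⟩ := hS (f.compContinuous ⟨h.symm, h.symm.continuous⟩)
  refine ⟨g.compContinuous ⟨φ, hφ.continuous⟩, fun x => ?_⟩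
  exact (hg (h x)).trans (congrArg f (h.symm_apply_apply x))

end General

namespace Plank

instance : Countable D := inferInstanceAs (Countable (List Bool))

instance : Infinite D := inferInstanceAs (Infinite (List Bool))

/-! ### Continuous functions on `ℂ` -/

namespace C

theorem isOpen_iff {U : Set C} : IsOpen U ↔ (infty ∈ U → Uᶜ.Countable) := Iff.rfl

theorem isClopen_pt (x : ℕ → Bool) : IsClopen {pt x} := by
  refine ⟨⟨isOpen_iff.2 fun _ => ?_⟩, isOpen_iff.2 fun h => by cases h⟩
  simp

theorem isClosed_infty : IsClosed {infty} :=
  ⟨isOpen_iff.2 fun h => absurd rfl h⟩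

theorem continuous_of_countable {Y : Type*} [TopologicalSpace Y] {f : C → Y}
    (hf : {z | f z ≠ f infty}.Countable) : Continuous f := by
  refine ⟨fun W _ => isOpen_iff.2 fun h => hf.mono ?_⟩
  intro z hz heq
  rw [mem_compl_iff, mem_preimage, heq] at hz
  exact hz h

/-- The preimage of each ball of radius `1/(n+1)` about `f ∞` has countable complement, and these
complements cover the set in question. -/
theorem countable_ne {f : C → ℝ} (hf : Continuous f) : {z | f z ≠ f infty}.Countable := by
  have h : ∀ n : ℕ, (f ⁻¹' Metric.ball (f infty) (1 / (n + 1)))ᶜ.Countable := fun n =>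
    isOpen_iff.1 (Metric.isOpen_ball.preimage hf) (Metric.mem_ball_self (by positivity))
  refine (countable_iUnion h).mono fun z hz => ?_
  obtain ⟨n, hn⟩ := exists_nat_one_div_lt (dist_pos.2 hz)
  exact mem_iUnion.2 ⟨n, fun h' => (lt_asymm hn) (Metric.mem_ball.1 h')⟩

/-- If `G` does not converge to `∞`, it contains a countable set. An injection of that set into `ℕ`,
set to `0` elsewhere, is continuous, and its convergence along `G` forces `G` to be principal. -/
theorem exists_le_nhds (G : Ultrafilter C) (hG : ∀ f : C(C, ℝ), ∃ r, Tendsto f G (𝓝 r)) :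
    ∃ c, (G : Filter C) ≤ 𝓝 c := by
  classical
  by_cases hinf : (G : Filter C) ≤ 𝓝 infty
  · exact ⟨_, hinf⟩
  obtain ⟨U, ⟨hmem, hU⟩, hUG⟩ : ∃ U, (infty ∈ U ∧ IsOpen U) ∧ U ∉ (G : Filter C) := by
    by_contra! h
    exact hinf ((nhds_basis_opens infty).ge_iff.2 h)
  have hUc : Uᶜ ∈ G := Ultrafilter.compl_mem_iff_notMem.2 hUG
  have hcount := isOpen_iff.1 hU hmem
  obtain ⟨k, hk⟩ := countable_iff_exists_injOn.1 hcount
  let f : C(C, ℝ) := ⟨fun z => if z ∈ U then 0 else (k z : ℝ), by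
    refine continuous_of_countable (hcount.mono ?_)
    intro z hz hzU
    simp [hzU, hmem] at hz⟩
  obtain ⟨r, hr⟩ := hG f
  -- Two integers within `1/2` of `r` differ by less than `1`, so this set has only one point.
  have hmemG : f ⁻¹' Metric.ball r (1 / 2) ∩ Uᶜ ∈ G :=
    inter_mem (hr (Metric.ball_mem_nhds r (by norm_num))) hUc
  obtain ⟨z, hz⟩ := G.nonempty_of_mem hmemG
  refine ⟨z, ?_⟩
  have hsub : f ⁻¹' Metric.ball r (1 / 2) ∩ Uᶜ ⊆ {z} := by
    intro w hw
    refine hk hw.2 hz.2 ?_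
    have h1 : dist (f w) (f z) < 1 := by
      have := dist_triangle_right (f w) (f z) r
      have h2 := Metric.mem_ball.1 hw.1
      have h3 := Metric.mem_ball.1 hz.1
      linarith
    have hfw : f w = k w := if_neg hw.2
    have hfz : f z = k z := if_neg hz.2
    rw [hfw, hfz, Nat.dist_cast_real, Nat.dist_eq] at h1
    have h4 : |(k w : ℤ) - k z| < 1 := by exact_mod_cast h1
    have := Int.abs_lt_one_iff.1 h4
    omega
  exact fun W hW => mem_of_superset hmemG
    (hsub.trans (singleton_subset_iff.2 (mem_of_mem_nhds hW)))

/-- A function is coded by its value at `∞`, a sequence listing the exceptional points, and its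
values there. -/
theorem mk_continuousMap_le : Cardinal.mk C(C, ℝ) ≤ Cardinal.continuum := by
  have h : ∀ f : C(C, ℝ), ∃ p : ℝ × (ℕ → ℕ → Bool) × (ℕ → ℝ),
      f infty = p.1 ∧ (∀ n, f (pt (p.2.1 n)) = p.2.2 n) ∧
        ∀ x, x ∉ range p.2.1 → f (pt x) = p.1 := by
    intro f
    have hc : {x | f (pt x) ≠ f infty}.Countable :=
      (countable_ne f.continuous).preimage (f := pt) fun x y h => by cases h; rfl
    -- The dummy point makes the set nonempty, hence the range of a sequence.
    obtain ⟨s, hs⟩ := (hc.insert fun _ => false).exists_eq_range (insert_nonempty _ _)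
    refine ⟨(f infty, s, fun n => f (pt (s n))), rfl, fun _ => rfl, fun x hx => ?_⟩
    by_contra hne
    exact hx (hs ▸ mem_insert_of_mem _ hne)
  choose p h1 h2 h3 using h
  have hinj : Function.Injective p := by
    intro f g hfg
    ext z
    cases z with
    | infty => rw [h1, h1, hfg]
    | pt x =>
      by_cases hx : x ∈ range (p f).2.1
      · obtain ⟨n, rfl⟩ := hx
        have := h2 g n
        rw [← hfg] at this
        rw [h2, this]
      · rw [h3 f x hx, h3 g x (hfg ▸ hx), hfg]
  refine (Cardinal.mk_le_of_injective hinj).trans ?_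
  simp [Cardinal.mk_real]

end C

/-! ### The map `e` and its fibres -/

section StoneCech

theorem continuous_e : Continuous e := continuous_stoneCechExtend _

@[simp]
theorem e_unit (s : D) : e (stoneCechUnit s) = CD.node s :=
  stoneCechExtend_stoneCechUnit continuous_of_discreteTopology s

/-- Any further point of the fibre would have a neighbourhood inside the fibre that misses `s`; by
density it would contain another `t ∈ D`, although `e` fixes `D`. -/
theorem e_eq_node_iff {v : StoneCech D} {s : D} : e v = CD.node s ↔ v = stoneCechUnit s := by
  refine ⟨fun h => ?_, fun h => h ▸ e_unit s⟩
  by_contra hne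
  have hV : IsOpen (e ⁻¹' {CD.node s} ∩ {stoneCechUnit s}ᶜ) :=
    ((CD.isOpen_node s).preimage continuous_e).inter isOpen_compl_singleton
  obtain ⟨t, ht, ht'⟩ := denseRange_stoneCechUnit.exists_mem_open hV ⟨v, h, hne⟩
  have h1 : CD.node t = CD.node s := (e_unit t).symm.trans ht
  cases h1
  exact ht' rfl

theorem isOpen_unit (s : D) : IsOpen {(stoneCechUnit s : StoneCech D)} := by
  have : {(stoneCechUnit s : StoneCech D)} = e ⁻¹' {CD.node s} := by
    ext v
    exact e_eq_node_iff.symm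
  rw [this]
  exact (CD.isOpen_node s).preimage continuous_e

theorem unit_injective : Function.Injective (stoneCechUnit : D → StoneCech D) := by
  intro s t h
  have h1 := congrArg e h
  rw [e_unit, e_unit] at h1
  cases h1
  rfl

theorem mem_remainder_iff {v : StoneCech D} : v ∈ remainder ↔ ∃ y, e v = CD.branch y := by
  constructor
  · intro hv
    rcases h : e v with s | y
    · exact absurd ⟨s, (e_eq_node_iff.1 h).symm⟩ hv
    · exact ⟨y, rfl⟩
  · rintro ⟨y, hy⟩ ⟨s, rfl⟩
    rw [e_unit] at hy
    cases hy

theorem mem_K_iff {x : ℕ → Bool} {v : StoneCech D} : v ∈ K x ↔ e v = CD.branch x :=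
  ⟨fun h => h.2, fun h => ⟨mem_remainder_iff.2 ⟨x, h⟩, h⟩⟩

theorem branch_mem_closure (x : ℕ → Bool) : CD.branch x ∈ closure (range CD.node) := by
  refine mem_closure_iff.2 fun W hW hx => ?_
  obtain ⟨n, hn⟩ := CD.isOpen_iff.1 hW x hx
  refine ⟨CD.node (List.ofFn fun i : Fin n => x i), hn fun i hi => ?_, mem_range_self _⟩
  simp [CD.val, hi]

theorem wedge_mem_nhds (x : ℕ → Bool) (n : ℕ) : wedge x n ∈ 𝓝 (CD.branch x) := by
  have h : ∀ᶠ t in 𝓝 (CD.branch x), ∀ i ∈ Set.Iio n, t.val i = some (x i) :=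
    (eventually_all_finite (Set.finite_Iio n)).2 fun i _ =>
      (CD.isOpen_coord i (some (x i))).mem_nhds rfl
  exact h

/-- The range of `e` is compact, hence closed, and contains the dense set `D`. -/
theorem K_nonempty (x : ℕ → Bool) : (K x).Nonempty := by
  have hcl : IsClosed (range e) := (isCompact_range continuous_e).isClosed
  have hsub : range CD.node ⊆ range e := by
    rintro _ ⟨s, rfl⟩
    exact ⟨_, e_unit s⟩
  obtain ⟨v, hv⟩ := closure_minimal hsub hcl (branch_mem_closure x)
  exact ⟨v, mem_K_iff.2 hv⟩

end StoneCech

/-! ### Splitting level from a branch -/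

section Split

/-- The length of the longest common initial segment of `t` and `y` (`0` if `t = y`). -/
noncomputable def split (y : ℕ → Bool) (t : CD) : ℕ := sInf {i | t.val i ≠ some (y i)}

theorem split_spec {y : ℕ → Bool} {t : CD} (h : t ≠ CD.branch y) :
    t.val (split y t) ≠ some (y (split y t)) :=
  Nat.sInf_mem (s := {i | t.val i ≠ some (y i)})
    (Function.ne_iff.1 (CD.val_injective.ne h))

theorem eq_of_lt_split {y : ℕ → Bool} {t : CD} {i : ℕ} (h : i < split y t) :
    t.val i = some (y i) :=
  not_not.1 (Nat.notMem_of_lt_sInf h)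

theorem le_split {y : ℕ → Bool} {t : CD} (h : t ≠ CD.branch y) {n : ℕ} (ht : t ∈ wedge y n) :
    n ≤ split y t :=
  not_lt.1 fun hlt => split_spec h (ht _ hlt)

theorem split_eq {y : ℕ → Bool} {t : CD} {n : ℕ} (h : t.val n ≠ some (y n))
    (ht : ∀ i < n, t.val i = some (y i)) : split y t = n := by
  have hne : t ≠ CD.branch y := fun h' => h (h' ▸ rfl)
  exact le_antisymm (Nat.sInf_le h) (le_split hne ht)

/-- The splitting level is determined by the coordinates up to and including it, so it is locally
constant away from `y`. -/
theorem continuousAt_split {y : ℕ → Bool} {t : CD} (h : t ≠ CD.branch y) :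
    ContinuousAt (split y) t := by
  have hev : ∀ᶠ t' in 𝓝 t, ∀ i ∈ Set.Iic (split y t), t'.val i = t.val i :=
    (eventually_all_finite (Set.finite_Iic _)).2 fun i _ => (CD.isOpen_coord i (t.val i)).mem_nhds rfl
  refine (continuousAt_const (y := split y t)).congr (hev.mono fun t' ht' => ?_)
  refine (split_eq (ht' _ self_mem_Iic ▸ split_spec h) fun i hi => ?_).symm
  rw [ht' i hi.le, eq_of_lt_split hi]

end Split

/-! ### Points of `Q` and the copies of `ℕ` -/

section PlankPoints

theorem mem_plankSet_iff {p : C × StoneCech D} :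
    p ∈ plankSet ↔ p.2 ∈ range (stoneCechUnit : D → StoneCech D) ∨
      ∃ x, p.1 = C.pt x ∧ e p.2 = CD.branch x := by
  simp [plankSet, mem_K_iff]

theorem mem_T_iff {a : A} : a ∈ T ↔ ∃ x, a.1.1 = C.pt x ∧ e a.1.2 = CD.branch x := by
  simp [T, mem_K_iff]

/-- The point `(c, d)` of the plank. -/
def pnt (c : C) (d : D) : A := ⟨(c, stoneCechUnit d), Or.inl ⟨mem_univ _, mem_range_self d⟩⟩

theorem eq_pnt_or_mem_T (a : A) : (∃ d, a = pnt a.1.1 d) ∨ a ∈ T := by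
  rcases mem_plankSet_iff.1 a.2 with ⟨d, hd⟩ | h
  · exact Or.inl ⟨d, Subtype.ext (Prod.ext rfl hd.symm)⟩
  · exact Or.inr (mem_T_iff.2 h)

theorem pnt_notMem_T (c : C) (d : D) : pnt c d ∉ T := by
  rw [mem_T_iff]
  rintro ⟨x, -, h⟩
  cases (e_unit d).symm.trans h

theorem mem_R_iff {a : A} : a ∈ R ↔ ∃ d, a = pnt C.infty d := by
  constructor
  · rintro ⟨h, d, hd⟩
    exact ⟨d, Subtype.ext (Prod.ext h hd.symm)⟩
  · rintro ⟨d, rfl⟩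
    exact ⟨rfl, mem_range_self d⟩

theorem continuous_pnt (d : D) : Continuous fun c => pnt c d := by
  unfold pnt
  fun_prop

/-- The point `(a, i)` of the quotient. -/
def mkQ (a : A) (i : Fin 2) : Q := Quotient.mk glue (a, i)

theorem continuous_mkQ : Continuous fun p : A × Fin 2 => mkQ p.1 p.2 := continuous_quotient_mk'

theorem mkQ_eq_iff {a b : A} {i j : Fin 2} : mkQ a i = mkQ b j ↔ a = b ∧ (i = j ∨ a ∈ T) :=
  Quotient.eq (r := glue)

theorem Q.ind {motive : Q → Prop} (h : ∀ a i, motive (mkQ a i)) (q : Q) : motive q :=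
  Quotient.ind (fun p => h p.1 p.2) q

/-- The projection of `Q` to the plank. -/
def toA : Q → A := Quotient.lift (fun p : A × Fin 2 => p.1) fun _ _ h => h.1

theorem continuous_toA : Continuous toA := continuous_fst.quotient_lift _

/-- The points of `D × {0, 1}` on the right-hand side of `Q`. -/
def right (p : D × Fin 2) : Q := mkQ (pnt C.infty p.1) p.2

theorem RCopy_eq_range (i : Fin 2) : RCopy i = range fun d => right (d, i) := by
  ext q
  constructor
  · rintro ⟨⟨a, j⟩, ⟨ha, hj⟩, rfl⟩
    obtain ⟨d, rfl⟩ := mem_R_iff.1 ha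
    cases hj
    exact ⟨d, rfl⟩
  · rintro ⟨d, rfl⟩
    exact ⟨(pnt C.infty d, i), ⟨mem_R_iff.2 ⟨d, rfl⟩, rfl⟩, rfl⟩

theorem RCopy_union : RCopy 0 ∪ RCopy 1 = range right := by
  ext q
  simp [RCopy_eq_range, Prod.exists, Fin.exists_fin_two, exists_or]

theorem pnt_injective (c : C) : Function.Injective (pnt c) := fun _ _ h =>
  unit_injective (congrArg (fun a : A => a.1.2) h)

theorem right_injective : Function.Injective right := by
  rintro ⟨d, i⟩ ⟨d', i'⟩ h
  obtain ⟨h1, h2⟩ := mkQ_eq_iff.1 h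
  exact Prod.ext (pnt_injective _ h1) (h2.resolve_right (pnt_notMem_T _ _))

theorem isClopen_column (d : D) (i : Fin 2) : IsClopen (range fun c => mkQ (pnt c d) i) := by
  have hq : IsQuotientMap fun p : A × Fin 2 => mkQ p.1 p.2 := isQuotientMap_quotient_mk'
  refine hq.isClopen_preimage.1 ?_
  have : (fun p : A × Fin 2 => mkQ p.1 p.2) ⁻¹' (range fun c => mkQ (pnt c d) i) =
      (fun p : A × Fin 2 => p.1.1.2) ⁻¹' {stoneCechUnit d} ∩ Prod.snd ⁻¹' {i} := by
    ext ⟨a, j⟩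
    constructor
    · rintro ⟨c, hc⟩
      obtain ⟨h1, h2⟩ := mkQ_eq_iff.1 hc
      subst h1
      exact ⟨rfl, (h2.resolve_right (pnt_notMem_T _ _)).symm⟩
    · rintro ⟨h1, h2⟩
      cases h2
      exact ⟨a.1.1, congrArg (mkQ · j) (Subtype.ext (Prod.ext rfl (Eq.symm h1)))⟩
  rw [this]
  exact (IsClopen.preimage ⟨isClosed_singleton, isOpen_unit d⟩ (by fun_prop)).inter
    ((isClopen_discrete _).preimage continuous_snd)

theorem isClosedEmbedding_right : IsClosedEmbedding right := by
  refine .of_continuous_injective_isClosedMap continuous_of_discreteTopology right_injective ?_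
  intro B _
  -- Every subset of the right-hand side is closed: its complement consists of the points off `∞`
  -- and the clopen columns of the omitted points.
  have : (right '' B)ᶜ = (fun q => (toA q).1.1) ⁻¹' {C.infty}ᶜ ∪
      ⋃ p ∈ Bᶜ, range fun c => mkQ (pnt c p.1) p.2 := by
    ext q
    induction q using Q.ind with | _ a i
    constructor
    · intro hq
      by_cases ha : a.1.1 = C.infty
      · rcases eq_pnt_or_mem_T a with ⟨d, hd⟩ | hT
        · rw [ha] at hd
          subst hd
          exact Or.inr (mem_iUnion₂.2 ⟨(d, i), fun hB => hq ⟨_, hB, rfl⟩, C.infty, rfl⟩)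
        · obtain ⟨x, hx, -⟩ := mem_T_iff.1 hT
          cases ha.symm.trans hx
      · exact Or.inl ha
    · rintro (hq | hq) ⟨p, hp, hpq⟩
      · refine hq ?_
        rw [← hpq]
        rfl
      · obtain ⟨p', hp', c, hc⟩ := mem_iUnion₂.1 hq
        obtain ⟨h1, h2⟩ := mkQ_eq_iff.1 (hc.trans hpq.symm)
        have h3 := h2.resolve_right (pnt_notMem_T _ _)
        have h4 := unit_injective (congrArg (fun a : A => a.1.2) h1)
        exact hp' (Prod.ext h4 h3 ▸ hp)
  refine ⟨this ▸ IsOpen.union ?_ (isOpen_biUnion fun p _ => (isClopen_column p.1 p.2).isOpen)⟩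
  exact C.isClosed_infty.isOpen_compl.preimage
    (continuous_fst.comp (continuous_subtype_val.comp continuous_toA))

theorem isClosedEmbedding_right_slice (i : Fin 2) : IsClosedEmbedding fun d => right (d, i) :=
  isClosedEmbedding_right.comp <| .of_continuous_injective_isClosedMap (f := fun d : D => (d, i))
    continuous_of_discreteTopology (Prod.mk_left_injective i) fun _ _ => isClosed_discrete _

theorem isClosedCopyOfNat_RCopy (i : Fin 2) : IsClosedCopyOfNat (RCopy i) := by
  rw [RCopy_eq_range]
  exact .range (isClosedEmbedding_right_slice i) (Classical.choice (nonempty_equiv_of_countable (α := D) (β := ℕ)))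

theorem isClosedCopyOfNat_union : IsClosedCopyOfNat (RCopy 0 ∪ RCopy 1) := by
  rw [RCopy_union]
  exact .range isClosedEmbedding_right
    (Classical.choice (nonempty_equiv_of_countable (α := D × Fin 2) (β := ℕ)))

theorem disjoint_RCopy : Disjoint (RCopy 0) (RCopy 1) := by
  rw [RCopy_eq_range, RCopy_eq_range, Set.disjoint_left]
  rintro _ ⟨d, rfl⟩ ⟨d', h⟩
  have := congrArg Prod.snd (right_injective h)
  simp at this

theorem cStarEmbedded_RCopy (i : Fin 2) : CStarEmbedded (RCopy i) := by
  intro f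
  have hmem : ∀ d, right (d, i) ∈ RCopy i := fun d => by
    rw [RCopy_eq_range]
    exact mem_range_self d
  let h : D → Icc (-‖f‖) ‖f‖ := fun d => ⟨f ⟨_, hmem d⟩, abs_le.1 (f.norm_coe_le_norm _)⟩
  have hh : Continuous h := continuous_of_discreteTopology
  let g : Q → ℝ := fun q => (stoneCechExtend hh (toA q).1.2 : Icc (-‖f‖) ‖f‖)
  have hg : Continuous g := continuous_subtype_val.comp <| (continuous_stoneCechExtend hh).comp <|
    continuous_snd.comp <| continuous_subtype_val.comp continuous_toA
  refine ⟨.ofNormedAddCommGroup g hg ‖f‖ fun q => abs_le.2 (stoneCechExtend hh _).2, ?_⟩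
  rintro ⟨q, hq⟩
  have hq' := hq
  rw [RCopy_eq_range] at hq'
  obtain ⟨d, rfl⟩ := hq'
  exact congrArg Subtype.val (stoneCechExtend_stoneCechUnit hh d)

end PlankPoints

/-! ### Density of the columns: non-extension and cardinality -/

section Density

/-- Every point of the top line of `Q` is a limit of points of `{x} × D × {i}`. -/
theorem exists_tendsto_pnt {a : A} (i : Fin 2) :
    ∃ F : Filter D, F.NeBot ∧ Tendsto (fun d => mkQ (pnt a.1.1 d) i) F (𝓝 (mkQ a i)) := by
  refine ⟨comap stoneCechUnit (𝓝 a.1.2),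
    isDenseInducing_stoneCechUnit.comap_nhds_neBot _, ?_⟩
  refine (continuous_mkQ.tendsto (a, i)).comp (Tendsto.prodMk_nhds ?_ tendsto_const_nhds)
  exact tendsto_subtype_rng.2 (Tendsto.prodMk_nhds tendsto_const_nhds tendsto_comap)

theorem not_cStarEmbedded_union : ¬ CStarEmbedded (RCopy 0 ∪ RCopy 1) := by
  classical
  rw [RCopy_union]
  intro h
  have : DiscreteTopology (range right) :=
    isClosedEmbedding_right.isEmbedding.toHomeomorph.symm.isEmbedding.discreteTopology
  let f : BoundedContinuousFunction (range right) ℝ := .ofNormedAddCommGroup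
    (fun q => if (q : Q) ∈ RCopy 1 then 1 else 0) continuous_of_discreteTopology 1 fun q => by
      split_ifs <;> simp
  obtain ⟨g, hg⟩ := h f
  have hval : ∀ d i, g (right (d, i)) = (i : ℕ) := by
    intro d i
    rw [hg ⟨_, mem_range_self _⟩]
    have hiff : right (d, i) ∈ RCopy 1 ↔ i = 1 := by
      rw [RCopy_eq_range]
      constructor
      · rintro ⟨d', h⟩
        exact (congrArg Prod.snd (right_injective h)).symm
      · rintro rfl
        exact mem_range_self d
    change (if right (d, i) ∈ RCopy 1 then (1 : ℝ) else 0) = _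
    rw [if_congr hiff rfl rfl]
    fin_cases i <;> simp
  have hcont : ∀ d i, Continuous fun c => g (mkQ (pnt c d) i) := fun d i =>
    g.continuous.comp (continuous_mkQ.comp ((continuous_pnt d).prodMk continuous_const))
  have hcount : (⋃ p : D × Fin 2,
      {c | g (mkQ (pnt c p.1) p.2) ≠ g (mkQ (pnt C.infty p.1) p.2)}).Countable :=
    countable_iUnion fun p => C.countable_ne (hcont p.1 p.2)
  obtain ⟨x, hx⟩ : ∃ x : ℕ → Bool, C.pt x ∉ ⋃ p : D × Fin 2,
      {c | g (mkQ (pnt c p.1) p.2) ≠ g (mkQ (pnt C.infty p.1) p.2)} := by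
    by_contra! hall
    have h1 : (univ : Set (ℕ → Bool)).Countable :=
      (hcount.preimage (f := C.pt) fun x y h => by cases h; rfl).mono fun x _ => hall x
    have h2 := Cardinal.mk_le_aleph0_iff.2 (countable_univ_iff.1 h1)
    simp at h2
    exact absurd h2 Cardinal.aleph0_lt_continuum.not_ge
  have hx' : ∀ d i, g (mkQ (pnt (C.pt x) d) i) = (i : ℕ) := by
    intro d i
    by_contra hne
    exact hx (mem_iUnion.2 ⟨(d, i), fun heq => hne (heq.trans (hval d i))⟩)
  obtain ⟨u, hu⟩ := K_nonempty x
  have hp : (C.pt x, u) ∈ plankSet := mem_plankSet_iff.2 (Or.inr ⟨x, rfl, mem_K_iff.1 hu⟩)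
  have hlim : ∀ i : Fin 2, g (mkQ ⟨_, hp⟩ i) = (i : ℕ) := by
    intro i
    obtain ⟨F, hF, hT⟩ := exists_tendsto_pnt (a := ⟨_, hp⟩) i
    refine tendsto_nhds_unique ((g.continuous.tendsto _).comp hT) ?_
    exact tendsto_const_nhds.congr fun d => (hx' d i).symm
  have heq : mkQ ⟨_, hp⟩ 0 = mkQ ⟨_, hp⟩ 1 :=
    mkQ_eq_iff.2 ⟨rfl, Or.inr (mem_T_iff.2 ⟨x, rfl, mem_K_iff.1 hu⟩)⟩
  have h0 := hlim 0
  rw [heq, hlim 1] at h0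
  simp at h0

/-- The countably many columns have dense union, so restriction to them embeds `C(Q)` in a set of
size at most `𝔠^ω = 𝔠`. -/
theorem mk_continuousMap : Cardinal.mk C(Q, ℝ) = Cardinal.continuum := by
  apply le_antisymm
  · let r : C(Q, ℝ) → D × Fin 2 → C(C, ℝ) := fun f p => ⟨fun c => f (mkQ (pnt c p.1) p.2),
      f.continuous.comp (continuous_mkQ.comp ((continuous_pnt p.1).prodMk continuous_const))⟩
    have hr : Function.Injective r := by
      intro f g hfg
      ext q
      induction q using Q.ind with | _ a i
      obtain ⟨F, hF, hT⟩ := exists_tendsto_pnt (a := a) i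
      refine tendsto_nhds_unique ((f.continuous.tendsto _).comp hT) ?_
      refine ((g.continuous.tendsto _).comp hT).congr fun d => ?_
      exact (DFunLike.congr_fun (congrFun hfg (d, i)) a.1.1).symm
    refine (Cardinal.mk_le_of_injective hr).trans ?_
    rw [← Cardinal.power_def]
    refine (Cardinal.power_le_power_right C.mk_continuousMap_le).trans ?_
    simp
  · rw [← Cardinal.mk_real]
    refine Cardinal.mk_le_of_injective (f := ContinuousMap.const Q) fun a b h => ?_
    exact DFunLike.congr_fun h (mkQ (pnt C.infty []) 0)

end Density

/-! ### Separation of points and realcompactness -/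

section Realcompactness

/-- Urysohn functions separate the `βD`-coordinates, clopen singletons the `ℂ`-coordinates, and
clopen columns the two sheets off `T`. -/
theorem eq_of_forall_continuousMap (q q' : Q) (h : ∀ f : C(Q, ℝ), f q = f q') : q = q' := by
  have hclopen : ∀ S : Set Q, IsClopen S → q ∈ S → q' ∈ S := by
    intro S hS hq
    by_contra hq'
    have := h ⟨S.indicator fun _ => 1, continuous_const.indicator fun _ hx => by simp [hS.frontier_eq] at hx⟩
    simp [hq, hq'] at this
  induction q using Q.ind with | _ a i
  induction q' using Q.ind with | _ b j
  have h2 : a.1.2 = b.1.2 := by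
    by_contra hne
    obtain ⟨f, hf, hf', -⟩ := exists_continuous_zero_one_of_isClosed
      (isClosed_singleton (x := a.1.2)) (isClosed_singleton (x := b.1.2))
      (disjoint_singleton.2 hne)
    have := h (f.comp ⟨_, continuous_snd.comp (continuous_subtype_val.comp continuous_toA)⟩)
    change f a.1.2 = f b.1.2 at this
    rw [hf rfl, hf' rfl] at this
    simp at this
  have h1 : a.1.1 = b.1.1 := by
    have key : ∀ x, a.1.1 = C.pt x ↔ b.1.1 = C.pt x := fun x => by
      have hS : IsClopen ((fun q => (toA q).1.1) ⁻¹' {C.pt x}) := (C.isClopen_pt x).preimage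
        (continuous_fst.comp (continuous_subtype_val.comp continuous_toA))
      exact ⟨hclopen _ hS, fun hb => not_not.1 fun ha => hclopen _ hS.compl ha hb⟩
    rcases ha : a.1.1 with x | _
    · exact ((key x).1 ha).symm
    · rcases hb : b.1.1 with x | _
      · cases ha.symm.trans ((key x).2 hb)
      · rfl
  obtain rfl : a = b := Subtype.ext (Prod.ext h1 h2)
  rcases eq_pnt_or_mem_T a with ⟨d, hd⟩ | hT
  · have := hclopen _ (isClopen_column d i) ⟨_, congrArg (mkQ · i) hd.symm⟩
    obtain ⟨c, hc⟩ := this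
    obtain ⟨h3, h4⟩ := mkQ_eq_iff.1 hc
    exact mkQ_eq_iff.2 ⟨rfl, Or.inl (h4.resolve_right (pnt_notMem_T _ _))⟩
  · exact mkQ_eq_iff.2 ⟨rfl, Or.inr hT⟩

open Classical in
/-- A continuous function on `Q` that tends to infinity at every point `(c, v)` of `ℂ × βD` with
`e v = y` and `c ≠ y`. -/
noncomputable def blowUp (y : ℕ → Bool) (q : Q) : ℝ :=
  if (toA q).1.1 = C.pt y then 0 else split y (e (toA q).1.2)

/-- The plank omits exactly the points where `blowUp y` would be infinite. -/
theorem e_ne_branch {a : A} {y : ℕ → Bool} (h : a.1.1 ≠ C.pt y) : e a.1.2 ≠ CD.branch y := by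
  intro he
  rcases mem_plankSet_iff.1 a.2 with ⟨d, hd⟩ | ⟨x, hx, hx'⟩
  · rw [← hd, e_unit] at he
    cases he
  · cases hx'.symm.trans he
    exact h hx

theorem continuous_blowUp (y : ℕ → Bool) : Continuous (blowUp y) := by
  have hfst : Continuous fun q => (toA q).1.1 :=
    continuous_fst.comp (continuous_subtype_val.comp continuous_toA)
  have hsnd : Continuous fun q => e (toA q).1.2 :=
    continuous_e.comp (continuous_snd.comp (continuous_subtype_val.comp continuous_toA))
  have hcl := (C.isClopen_pt y).preimage hfst
  refine continuous_iff_continuousAt.2 fun q => ?_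
  by_cases hq : (toA q).1.1 = C.pt y
  · refine (continuousAt_const (y := (0 : ℝ))).congr ?_
    filter_upwards [hcl.isOpen.mem_nhds hq] with q' hq'
    exact (if_pos hq').symm
  · have hs : ContinuousAt (fun q => (split y (e (toA q).1.2) : ℝ)) q :=
      (continuous_of_discreteTopology (f := ((↑) : ℕ → ℝ))).continuousAt.comp
        (ContinuousAt.comp (f := fun q => e (toA q).1.2) (continuousAt_split (e_ne_branch hq))
          hsnd.continuousAt)
    refine hs.congr ?_
    filter_upwards [hcl.compl.isOpen.mem_nhds hq] with q' hq'
    exact (if_neg hq').symm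

theorem exists_le_nhds (U : Ultrafilter Q) (hU : ∀ f : C(Q, ℝ), ∃ r, Tendsto f U (𝓝 r)) :
    ∃ q, (U : Filter Q) ≤ 𝓝 q := by
  have hfst : Continuous fun q => (toA q).1.1 :=
    continuous_fst.comp (continuous_subtype_val.comp continuous_toA)
  have hsnd : Continuous fun q => (toA q).1.2 :=
    continuous_snd.comp (continuous_subtype_val.comp continuous_toA)
  obtain ⟨c, hc⟩ := C.exists_le_nhds (U.map fun q => (toA q).1.1)
    fun f => hU (f.comp ⟨_, hfst⟩)
  obtain ⟨v, -, hv⟩ := isCompact_univ.ultrafilter_le_nhds (U.map fun q => (toA q).1.2) (by simp)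
  have hc' : Tendsto (fun q => (toA q).1.1) U (𝓝 c) := hc
  have hv' : Tendsto (fun q => (toA q).1.2) U (𝓝 v) := hv
  have hp : (c, v) ∈ plankSet := by
    by_contra hp
    rw [mem_plankSet_iff, not_or] at hp
    obtain ⟨y, hy⟩ := mem_remainder_iff.1 hp.1
    have hcy : c ≠ C.pt y := fun h => hp.2 ⟨y, h, hy⟩
    obtain ⟨r, hr⟩ := hU ⟨_, continuous_blowUp y⟩
    obtain ⟨n, hn⟩ := exists_nat_gt r
    have h1 : ∀ᶠ q in U, blowUp y q < n := hr (Iio_mem_nhds hn)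
    have h2 : ∀ᶠ q in U, (toA q).1.1 ≠ C.pt y :=
      hc' ((C.isClopen_pt y).compl.isOpen.mem_nhds hcy)
    have h3 : ∀ᶠ q in U, e (toA q).1.2 ∈ wedge y n := by
      refine ((continuous_e.tendsto v).comp hv') ?_
      rw [hy]
      exact wedge_mem_nhds y n
    obtain ⟨q, hq1, hq2, hq3⟩ := (h1.and (h2.and h3)).exists
    rw [blowUp, if_neg hq2] at hq1
    exact (Nat.cast_lt.1 hq1).not_ge (le_split (e_ne_branch hq2) hq3)
  -- The chosen sheet need not be continuous in `q`; a limit along the ultrafilter suffices to lift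
  -- the convergence to `𝔸 × {0, 1}`.
  obtain ⟨i, -, hi⟩ := isCompact_univ.ultrafilter_le_nhds
    (U.map fun q => (Quotient.out q : A × Fin 2).2) (by simp)
  have hi' : Tendsto (fun q : Q => (Quotient.out q : A × Fin 2).2) U (𝓝 i) := hi
  have hout : ∀ q : Q, mkQ (toA q) (Quotient.out q : A × Fin 2).2 = q := fun q => by
    have h := Quotient.out_eq q
    have h' : toA q = (Quotient.out q : A × Fin 2).1 := congrArg toA h.symm
    rw [h']
    exact h
  have hA : Tendsto toA U (𝓝 ⟨_, hp⟩) := tendsto_subtype_rng.2 (hc'.prodMk_nhds hv')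
  refine ⟨mkQ ⟨_, hp⟩ i, ?_⟩
  have := (continuous_mkQ.tendsto (⟨_, hp⟩, i)).comp (hA.prodMk_nhds hi')
  exact (this.congr hout : Tendsto id _ _)

theorem isClosedEmbedding_eval_Q {I : Type*} (F : I → C(Q, ℝ)) (hF : Function.Surjective F) :
    IsClosedEmbedding (fun q i => F i q : Q → I → ℝ) :=
  isClosedEmbedding_eval F hF eq_of_forall_continuousMap exists_le_nhds

theorem realcompact_Q : Realcompact Q :=
  ⟨_, _, isClosedEmbedding_eval_Q id Function.surjective_id⟩

end Realcompactness

end Plank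

theorem mainTheorem3 :
    Realcompact Plank.Q ∧
    (∀ i : Fin 2, IsClosedCopyOfNat (Plank.RCopy i) ∧ CStarEmbedded (Plank.RCopy i)) ∧
    Disjoint (Plank.RCopy 0) (Plank.RCopy 1) ∧
    IsClosedCopyOfNat (Plank.RCopy 0 ∪ Plank.RCopy 1) ∧
    ¬ CStarEmbedded (Plank.RCopy 0 ∪ Plank.RCopy 1) ∧
    Cardinal.mk C(Plank.Q, ℝ) = Cardinal.continuum ∧
    (∀ I : Type u, Cardinal.mk I = Cardinal.continuum →
      ∃ φ : Plank.Q → (I → ℝ), IsClosedEmbedding φ ∧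
        IsClosedCopyOfNat (φ '' (Plank.RCopy 0 ∪ Plank.RCopy 1)) ∧
        ¬ CStarEmbedded (φ '' (Plank.RCopy 0 ∪ Plank.RCopy 1))) ∧
    ¬ (∀ (X : Type) [TopologicalSpace X], Realcompact X → ∀ N₁ N₂ : Set X,
      IsClosedCopyOfNat N₁ → IsClosedCopyOfNat N₂ → CStarEmbedded N₁ → CStarEmbedded N₂ →
        CStarEmbedded (N₁ ∪ N₂)) := by
  refine ⟨Plank.realcompact_Q,
    fun i => ⟨Plank.isClosedCopyOfNat_RCopy i, Plank.cStarEmbedded_RCopy i⟩,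
    Plank.disjoint_RCopy, Plank.isClosedCopyOfNat_union, Plank.not_cStarEmbedded_union,
    Plank.mk_continuousMap, fun I hI => ?_, fun h => ?_⟩
  -- Since `|I| = |C(Q)|`, the coordinates can be indexed by `I`.
  · obtain ⟨E⟩ : Nonempty (I ≃ C(Plank.Q, ℝ)) := by
      rw [← Cardinal.lift_mk_eq', hI, Plank.mk_continuousMap]
      simp
    have hφ := Plank.isClosedEmbedding_eval_Q E E.surjective
    exact ⟨_, hφ, Plank.isClosedCopyOfNat_union.image hφ,
      fun h => Plank.not_cStarEmbedded_union (h.of_image hφ.isEmbedding)⟩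
  · exact Plank.not_cStarEmbedded_union
      (h Plank.Q Plank.realcompact_Q _ _ (Plank.isClosedCopyOfNat_RCopy 0)
        (Plank.isClosedCopyOfNat_RCopy 1) (Plank.cStarEmbedded_RCopy 0)
        (Plank.cStarEmbedded_RCopy 1))
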